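/- Let $N\ge 2$ and $\varepsilon\in\,]0,1[$. Write $\mathcal C^{\varepsilon}(\mathbb R^N)$ for the space of bounded, globally $\varepsilon$-Hölder continuous functions, and $\mathcal C^{1,\varepsilon}(\mathbb R^k)$ for the space of bounded $C^1$ functions whose first derivatives belong to $\mathcal C^{\varepsilon}(\mathbb R^k)$. Let $\Sigma\subset\mathbb R^N$ be a compact hypersurface (embedded, without boundary) of class $\mathcal C^{1,\varepsilon}$: every point of $\Sigma$ has an open neighbourhood $U\subset\mathbb R^N$ on which there is a local equation of $\Sigma$, that is, a $C^1$ function $H:U\to\mathbb R$ with $\varepsilon$-Hölder continuous differential, such that $\Sigma\cap U=\{x\in U: H(x)=0\}$ and $dH\ne 0$ on $\Sigma\cap U$. Let $\mathcal T^{\varepsilon}_\Sigma$ be the set of all vector fields $X$ on $\mathbb R^N$ whose components and whose divergence (in the sense of distributions) belong to $\mathcal C^{\varepsilon}(\mathbb R^N)$ and which are tangent to $\Sigma$, i.e. $\partial_X H=0$ on $\Sigma\cap U$ for every local equation $H:U\to\mathbb R$ of $\Sigma$. Let $\mathcal C^{1+\varepsilon}_\Sigma$ be the set of all $f\in L^\infty(\mathbb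 R^N)$ such that the distribution $\operatorname{div}(fX)$ belongs to $\mathcal C^{\varepsilon}(\mathbb R^N)$ for every $X\in\mathcal T^{\varepsilon}_\Sigma$. If $f\in\mathcal C^{\varepsilon}(\mathbb R^N)$ and $f\in\mathcal C^{1+\varepsilon}_\Sigma$, then $f_{|\Sigma}\in\mathcal C^{1,\varepsilon}(\Sigma)$; that is, $f\circ\varphi\in\mathcal C^{1,\varepsilon}(\mathbb R^{N-1})$ for every local parametrization $\varphi:\mathbb R^{N-1}\to\Sigma$ of class $\mathcal C^{1,\varepsilon}$, i.e. every homeomorphism $\varphi$ of $\mathbb R^{N-1}$ onto a relatively open subset of $\Sigma$ whose components belong to $\mathcal C^{1,\varepsilon}(\mathbb R^{N-1})$ and whose differential is injective at every point. -/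

import Mathlib

open scoped NNReal ENNReal ContDiff Topology
open MeasureTheory

/-- The Hölder space `C^ε` of a (pseudo)metric space `A`, for `0 < ε < 1`:
bounded functions which are globally `ε`-Hölder continuous. -/
def MemHolderSpace {A F : Type*} [PseudoMetricSpace A] [NormedAddCommGroup F]
    (ε : ℝ≥0) (g : A → F) : Prop :=
  (∃ C : ℝ, ∀ x, ‖g x‖ ≤ C) ∧ ∃ C : ℝ≥0, HolderWith C ε g

/-- The Hölder space `C^{1,ε}(E)`: bounded functions of class `C^1` whose differential belongs
to `C^ε(E)`. -/
def MemC1HolderSpace {E F : Type*} [NormedAddCommGroup E] [NormedSpace ℝ E]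
    [NormedAddCommGroup F] [NormedSpace ℝ F] (ε : ℝ≥0) (g : E → F) : Prop :=
  ContDiff ℝ 1 g ∧ (∃ C : ℝ, ∀ x, ‖g x‖ ≤ C) ∧ MemHolderSpace ε (fderiv ℝ g)

/-- `H` is a local equation of class `C^{1,ε}`, on the open set `U`, of the hypersurface `S`. -/
structure IsLocalEquation {N : ℕ} (ε : ℝ≥0) (S U : Set (EuclideanSpace ℝ (Fin N)))
    (H : EuclideanSpace ℝ (Fin N) → ℝ) : Prop where
  isOpen : IsOpen U
  contDiffOn : ContDiffOn ℝ 1 H U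
  holder_fderiv : ∃ C : ℝ≥0, HolderOnWith C ε (fderiv ℝ H) U
  mem_iff : ∀ x ∈ U, x ∈ S ↔ H x = 0
  fderiv_ne_zero : ∀ x ∈ S ∩ U, fderiv ℝ H x ≠ 0

/-- `S` is an embedded hypersurface (without boundary) of class `C^{1,ε}` of `ℝ^N`: it has a
local equation of class `C^{1,ε}` around each of its points. -/
def IsC1HolderHypersurface {N : ℕ} (ε : ℝ≥0) (S : Set (EuclideanSpace ℝ (Fin N))) : Prop :=
  ∀ x ∈ S, ∃ (U : Set (EuclideanSpace ℝ (Fin N))) (H : EuclideanSpace ℝ (Fin N) → ℝ),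
    x ∈ U ∧ IsLocalEquation ε S U H

/-- `d` is the divergence, in the sense of distributions on `ℝ^N`, of the vector field `Y`. -/
def IsWeakDivergence {N : ℕ} (Y : EuclideanSpace ℝ (Fin N) → EuclideanSpace ℝ (Fin N))
    (d : EuclideanSpace ℝ (Fin N) → ℝ) : Prop :=
  ∀ ψ : EuclideanSpace ℝ (Fin N) → ℝ, ContDiff ℝ ∞ ψ → HasCompactSupport ψ →
    ∫ x, d x * ψ x = - ∫ x, fderiv ℝ ψ x (Y x)

/-- The distributional divergence of `Y` belongs to `C^ε(ℝ^N)`. -/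
def HasHolderDivergence {N : ℕ} (ε : ℝ≥0)
    (Y : EuclideanSpace ℝ (Fin N) → EuclideanSpace ℝ (Fin N)) : Prop :=
  ∃ d : EuclideanSpace ℝ (Fin N) → ℝ, MemHolderSpace ε d ∧ IsWeakDivergence Y d

/-- The set `T^ε_S` of the vector fields on `ℝ^N` with components and divergence in `C^ε` which
are tangent to `S`, i.e. `∂_X H = 0` on `S` for all local equations `H` of `S`. -/
structure IsTangentHolderField {N : ℕ} (ε : ℝ≥0) (S : Set (EuclideanSpace ℝ (Fin N)))
    (X : EuclideanSpace ℝ (Fin N) → EuclideanSpace ℝ (Fin N)) : Prop where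
  holder : ∀ i : Fin N, MemHolderSpace ε (fun x => X x i)
  holder_div : HasHolderDivergence ε X
  tangent : ∀ (U : Set (EuclideanSpace ℝ (Fin N))) (H : EuclideanSpace ℝ (Fin N) → ℝ),
    IsLocalEquation ε S U H → ∀ x ∈ S ∩ U, fderiv ℝ H x (X x) = 0

/-- The conormal space `C^{1+ε}_S`: functions `f ∈ L^∞(ℝ^N)` such that `div (f X) ∈ C^ε(ℝ^N)`
for all `X ∈ T^ε_S`. -/
def MemConormal {N : ℕ} (ε : ℝ≥0) (S : Set (EuclideanSpace ℝ (Fin N)))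
    (f : EuclideanSpace ℝ (Fin N) → ℝ) : Prop :=
  MemLp f ∞ volume ∧
    ∀ X : EuclideanSpace ℝ (Fin N) → EuclideanSpace ℝ (Fin N),
      IsTangentHolderField ε S X → HasHolderDivergence ε (fun x => f x • X x)

/-- `φ : ℝ^k → S` is a local parametrization of class `C^{1,ε}` of `S ⊆ ℝ^N`: a homeomorphism
onto a relatively open subset of `S` which is of class `C^{1,ε}` with injective differentials
(so that its inverse is, locally, of class `C^{1,ε}` too). -/
structure IsLocalParametrization {k N : ℕ} (ε : ℝ≥0) (S : Set (EuclideanSpace ℝ (Fin N)))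
    (φ : EuclideanSpace ℝ (Fin k) → S) : Prop where
  isOpenEmbedding : Topology.IsOpenEmbedding φ
  memC1Holder : MemC1HolderSpace ε (fun y => (φ y : EuclideanSpace ℝ (Fin N)))
  injective_fderiv : ∀ y, Function.Injective
    (fderiv ℝ (fun y => (φ y : EuclideanSpace ℝ (Fin N))) y)

/-- The space `C^{1,ε}(S)` of a `k`-dimensional submanifold `S ⊆ ℝ^N`: functions `g` on `S` such
that `g ∘ φ ∈ C^{1,ε}(ℝ^k)` for every local parametrization `φ` of class `C^{1,ε}` of `S`. -/
def MemC1HolderOnSubmanifold (k : ℕ) {N : ℕ} (ε : ℝ≥0) (S : Set (EuclideanSpace ℝ (Fin N)))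
    (g : S → ℝ) : Prop :=
  ∀ φ : EuclideanSpace ℝ (Fin k) → S, IsLocalParametrization ε S φ →
    MemC1HolderSpace ε (g ∘ φ)

/-! Near a point `p` of `S`, the hypersurface is a graph `l = γ` over `ker l`, with `γ` of class
`C^{1,ε}` and constant along a vector `ν` with `l ν = 1` (`exists_graph_of_level_set`). Let `P` be
the projection onto `ker l` along `ν`. The shear `Θ z = z + γ z • ν` preserves the measure and
carries `ker l` onto the graph. The image under `dΘ` of the constant field `P v` is `P v + dγ(v) ν`.
It is tangent to the graph, and it is divergence free although `dγ` is only Hölder, because `dγ(v)`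
does not vary along `ν`. After a smooth cutoff `χ` its divergence is `dχ(P v + dγ(v) ν)`, which is
`C^ε`, so the field is admissible in the definition of conormality
(`isTangentHolderField_graphField`).

Conormality makes `div (f X)` a `C^ε` function. Pulled back by `Θ`, this says that `u = (f χ) ∘ Θ`
has Hölder continuous weak derivatives in every direction of `ker l`
(`weak_lineDeriv_of_weak_divergence_graphField`). Since `u` and these derivatives are uniformly
continuous, mollification turns the weak identity into an estimate of increments at every point. It
can therefore be read on the null set `ker l`, and `u ∘ P` is of class `C^{1,ε}`
(`hasFDerivAt_comp_of_weak_lineDeriv`).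

On `S` near `p` one has `Θ (P x) = x` and `χ x = 1`, so `u ∘ P` extends `f` from `S`. Compactness of
`S` makes the resulting local bounds on `f ∘ φ` uniform
(`memC1HolderSpace_comp_of_local_extension`). -/

/-! ### Calculus in Hölder spaces -/

theorem holderWith_of_dist_le {A B : Type*} [PseudoMetricSpace A] [PseudoMetricSpace B]
    {C ε : ℝ≥0} {k : A → B} (h : ∀ x y, dist (k x) (k y) ≤ C * dist x y ^ (ε : ℝ)) :
    HolderWith C ε k := by
  intro x y
  have h1 := h x y
  rw [dist_nndist, dist_nndist, ← NNReal.coe_rpow, ← NNReal.coe_mul, NNReal.coe_le_coe] at h1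
  rw [edist_nndist, edist_nndist, ← ENNReal.coe_rpow_of_nonneg _ ε.coe_nonneg, ← ENNReal.coe_mul,
    ENNReal.coe_le_coe]
  exact h1

/-- A bounded function which is Hölder continuous at small scales belongs to `C^ε`. -/
theorem memHolderSpace_of_small_scale {A F : Type*} [PseudoMetricSpace A] [NormedAddCommGroup F]
    {ε : ℝ≥0} {k : A → F} {M C δ : ℝ} (hM : ∀ x, ‖k x‖ ≤ M) (hδ : 0 < δ)
    (h : ∀ x y, dist x y < δ → dist (k x) (k y) ≤ C * dist x y ^ (ε : ℝ)) :
    MemHolderSpace ε k := by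
  -- At distance at least `δ` the trivial bound `2 * M` is at most `2 * M / δ ^ ε` times `dist x y ^
  -- ε`; the `⊔ 0` only makes the constant nonnegative.
  refine ⟨⟨M, hM⟩, ⟨max C (2 * M / δ ^ (ε : ℝ)) ⊔ 0, le_max_right _ _⟩,
    holderWith_of_dist_le fun x y => ?_⟩
  have hd : 0 ≤ dist x y ^ (ε : ℝ) := by positivity
  rcases lt_or_ge (dist x y) δ with hxy | hxy
  · exact (h x y hxy).trans (mul_le_mul_of_nonneg_right
      ((le_max_left _ _).trans (le_max_left _ _)) hd)
  · have hM0 : 0 ≤ M := (norm_nonneg _).trans (hM x)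
    have hδε : 0 < δ ^ (ε : ℝ) := Real.rpow_pos_of_pos hδ _
    calc dist (k x) (k y) ≤ ‖k x‖ + ‖k y‖ := dist_le_norm_add_norm _ _
      _ ≤ 2 * M := by linarith [hM x, hM y]
      _ = 2 * M / δ ^ (ε : ℝ) * δ ^ (ε : ℝ) := by field_simp
      _ ≤ 2 * M / δ ^ (ε : ℝ) * dist x y ^ (ε : ℝ) := by gcongr
      _ ≤ _ := mul_le_mul_of_nonneg_right ((le_max_right _ _).trans (le_max_left _ _)) hd

namespace MemHolderSpace

variable {A B F G : Type*} [PseudoMetricSpace A] [PseudoMetricSpace B] [NormedAddCommGroup F]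
  [NormedAddCommGroup G] {ε : ℝ≥0}

theorem continuous {k : A → F} (hk : MemHolderSpace ε k) (hε : 0 < ε) : Continuous k := by
  obtain ⟨-, C, hC⟩ := hk
  exact hC.continuous hε

theorem const (c : F) : MemHolderSpace ε (fun _ : A => c) :=
  ⟨⟨‖c‖, fun _ => le_rfl⟩, 0, HolderWith.const⟩

theorem add {k l : A → F} (hk : MemHolderSpace ε k) (hl : MemHolderSpace ε l) :
    MemHolderSpace ε (fun x => k x + l x) := by
  obtain ⟨⟨M, hM⟩, C, hC⟩ := hk
  obtain ⟨⟨M', hM'⟩, C', hC'⟩ := hl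
  exact ⟨⟨M + M', fun x => (norm_add_le _ _).trans (add_le_add (hM x) (hM' x))⟩, C + C', hC.add hC'⟩

theorem sum {ι : Type*} (s : Finset ι) {k : ι → A → F} (hk : ∀ i ∈ s, MemHolderSpace ε (k i)) :
    MemHolderSpace ε (fun x => ∑ i ∈ s, k i x) := by
  classical
  induction s using Finset.induction_on with
  | empty => simpa using const (0 : F)
  | insert a s ha ih =>
    simp only [Finset.sum_insert ha]
    exact (hk a (Finset.mem_insert_self a s)).add
      (ih fun i hi => hk i (Finset.mem_insert_of_mem hi))

theorem comp_lipschitz {k : B → F} (hk : MemHolderSpace ε k) {K : ℝ≥0} {g : A → B}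
    (hg : LipschitzWith K g) : MemHolderSpace ε (fun x => k (g x)) := by
  obtain ⟨⟨M, hM⟩, C, hC⟩ := hk
  refine ⟨⟨M, fun x => hM _⟩, C * K ^ (ε : ℝ), ?_⟩
  have := hC.comp (holderWith_one.2 hg)
  rwa [mul_one] at this

variable [NormedSpace ℝ F] [NormedSpace ℝ G]

/-- `C^ε` is stable under continuous bilinear operations. -/
theorem bilin {H : Type*} [NormedAddCommGroup H] [NormedSpace ℝ H] (L : F →L[ℝ] G →L[ℝ] H)
    {k : A → F} {l : A → G} (hk : MemHolderSpace ε k) (hl : MemHolderSpace ε l) :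
    MemHolderSpace ε (fun x => L (k x) (l x)) := by
  obtain ⟨⟨M, hM⟩, C, hC⟩ := hk
  obtain ⟨⟨M', hM'⟩, C', hC'⟩ := hl
  have bound : ∀ (a : F) (b : G) (α β : ℝ), ‖a‖ ≤ α → ‖b‖ ≤ β → ‖L a b‖ ≤ ‖L‖ * α * β := by
    intro a b α β ha hb
    refine (L.le_opNorm₂ a b).trans ?_
    have := (norm_nonneg a).trans ha
    gcongr
  refine memHolderSpace_of_small_scale (M := ‖L‖ * M * M') (C := ‖L‖ * M * C' + ‖L‖ * C * M')
    (fun x => bound _ _ _ _ (hM x) (hM' x)) one_pos fun x y _ => ?_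
  have h1 := hC.dist_le x y
  have h2 := hC'.dist_le x y
  rw [dist_eq_norm] at h1 h2 ⊢
  have : L (k x) (l x) - L (k y) (l y) = L (k x) (l x - l y) + L (k x - k y) (l y) := by
    simp
  rw [this]
  refine (norm_add_le _ _).trans ?_
  linarith [bound _ _ _ _ (hM x) h2, bound _ _ _ _ h1 (hM' y)]

theorem mul {k l : A → ℝ} (hk : MemHolderSpace ε k) (hl : MemHolderSpace ε l) :
    MemHolderSpace ε (fun x => k x * l x) :=
  bilin (ContinuousLinearMap.mul ℝ ℝ) hk hl

theorem smul {k : A → ℝ} {l : A → F} (hk : MemHolderSpace ε k) (hl : MemHolderSpace ε l) :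
    MemHolderSpace ε (fun x => k x • l x) :=
  bilin (ContinuousLinearMap.lsmul ℝ ℝ) hk hl

theorem clm (L : F →L[ℝ] G) {k : A → F} (hk : MemHolderSpace ε k) :
    MemHolderSpace ε (fun x => L (k x)) :=
  bilin (ContinuousLinearMap.id ℝ (F →L[ℝ] G)) (const L) hk

end MemHolderSpace

/-- Bounded Lipschitz functions belong to `C^ε`. -/
theorem LipschitzWith.memHolderSpace {A F : Type*} [PseudoMetricSpace A] [NormedAddCommGroup F]
    {ε K : ℝ≥0} {k : A → F}
    (hk : LipschitzWith K k) (hε : ε < 1)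
    (hb : ∃ M, ∀ x, ‖k x‖ ≤ M) : MemHolderSpace ε k := by
  obtain ⟨M, hM⟩ := hb
  refine memHolderSpace_of_small_scale hM one_pos (C := K) fun x y hxy => ?_
  refine (hk.dist_le_mul x y).trans (mul_le_mul_of_nonneg_left ?_ K.coe_nonneg)
  rcases (dist_nonneg (x := x) (y := y)).eq_or_lt with h0 | h0
  · rw [← h0]; positivity
  · calc dist x y = dist x y ^ (1 : ℝ) := (Real.rpow_one _).symm
      _ ≤ _ := Real.rpow_le_rpow_of_exponent_ge h0 hxy.le (by exact_mod_cast hε.le)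

section

variable {E F : Type*} [NormedAddCommGroup E] [NormedSpace ℝ E]
    [NormedAddCommGroup F] [NormedSpace ℝ F] {ε : ℝ≥0}

theorem lipschitzWith_of_memHolderSpace_fderiv {g : E → F} (hg : ContDiff ℝ 1 g)
    (h : MemHolderSpace ε (fderiv ℝ g)) : ∃ K, LipschitzWith K g := by
  obtain ⟨⟨M, hM⟩, -⟩ := h
  refine ⟨M.toNNReal,
    lipschitzWith_of_nnnorm_fderiv_le (hg.differentiable one_ne_zero) fun x => ?_⟩
  rw [← norm_toNNReal]
  exact Real.toNNReal_le_toNNReal (hM x)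

theorem ContDiff.memHolderSpace_of_hasCompactSupport {k : E → F} (hk : ContDiff ℝ 1 k)
    (hs : HasCompactSupport k) (hε : ε < 1) : MemHolderSpace ε k := by
  obtain ⟨K, hK⟩ := hk.lipschitzWith_of_hasCompactSupport hs one_ne_zero
  exact hK.memHolderSpace hε (hs.exists_bound_of_continuous hk.continuous)

end

/-- If `k` is Hölder continuous on a ball and vanishes off a smaller concentric ball, then it is
globally Hölder continuous. -/
theorem memHolderSpace_of_eq_zero_off_ball {E F : Type*} [PseudoMetricSpace E]
    [NormedAddCommGroup F] {ε : ℝ≥0} {k : E → F} {q : E} {r s M : ℝ} {C : ℝ≥0}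
    (hrs : s < r) (hM : ∀ x, ‖k x‖ ≤ M) (hC : HolderOnWith C ε k (Metric.ball q r))
    (h0 : ∀ x, x ∉ Metric.closedBall q s → k x = 0) : MemHolderSpace ε k := by
  refine memHolderSpace_of_small_scale hM (sub_pos.2 hrs) (C := C) fun x y hxy => ?_
  have tri1 := dist_triangle x y q
  have tri2 := dist_triangle_left y q x
  by_cases hx : x ∈ Metric.ball q r
  · by_cases hy : y ∈ Metric.ball q r
    · exact hC.dist_le hx hy
    · simp only [Metric.mem_ball, not_lt] at hx hy
      rw [h0 x, h0 y, dist_self]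
      · positivity
      · simp only [Metric.mem_closedBall]; linarith
      · simp only [Metric.mem_closedBall]; linarith
  · simp only [Metric.mem_ball, not_lt] at hx
    rw [h0 x, h0 y, dist_self]
    · positivity
    · simp only [Metric.mem_closedBall]; linarith
    · simp only [Metric.mem_closedBall]; linarith

/-! ### Local inverses, localization and graphs of class `C^{1,ε}` -/

section

variable {E F : Type*} [NormedAddCommGroup E] [NormedSpace ℝ E] [NormedAddCommGroup F]
  [NormedSpace ℝ F] {ε : ℝ≥0}

theorem ContDiffAt.continuousAt_fderiv_one {g : E → F} {q : E} (hg : ContDiffAt ℝ 1 g q) :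
    ContinuousAt (fderiv ℝ g) q :=
  (hg.fderiv_right (m := 0) (by norm_num)).continuousAt

/-- The local inverse of a `C^{1,ε}` map is of class `C^{1,ε}`. -/
theorem exists_local_inverse_holder_fderiv [CompleteSpace E] {Ψ : E → E} {p : E} {U : Set E}
    {C : ℝ≥0} (hU : U ∈ 𝓝 p) (hΨ : ContDiffAt ℝ 1 Ψ p) (hdiff : ∀ x ∈ U, DifferentiableAt ℝ Ψ x)
    (hC : HolderOnWith C ε (fderiv ℝ Ψ) U) (hid : fderiv ℝ Ψ p = ContinuousLinearMap.id ℝ E) :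
    ∃ Φ : E → E, Φ (Ψ p) = p ∧ ContDiffAt ℝ 1 Φ (Ψ p) ∧ (∀ᶠ y in 𝓝 (Ψ p), Ψ (Φ y) = y) ∧
      (∀ᶠ x in 𝓝 p, Φ (Ψ x) = x) ∧
      ∃ C' : ℝ≥0, ∃ t ∈ 𝓝 (Ψ p), HolderOnWith C' ε (fderiv ℝ Φ) t := by
  have hd : HasFDerivAt Ψ ((ContinuousLinearEquiv.refl ℝ E : E ≃L[ℝ] E) : E →L[ℝ] E) p := by
    have := (hdiff p (mem_of_mem_nhds hU)).hasFDerivAt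
    rw [hid] at this
    exact this
  have hs := hΨ.hasStrictFDerivAt' hd one_ne_zero
  set Φ := hs.localInverse Ψ _ p with hΦ
  have hΦp : Φ (Ψ p) = p := hs.localInverse_apply_image
  have hΦc : ContDiffAt ℝ 1 Φ (Ψ p) := hΨ.to_localInverse hd one_ne_zero
  have hr : ∀ᶠ y in 𝓝 (Ψ p), Ψ (Φ y) = y := hs.eventually_right_inverse
  have hl : ∀ᶠ x in 𝓝 p, Φ (Ψ x) = x := hs.eventually_left_inverse
  refine ⟨Φ, hΦp, hΦc, hr, hl, ?_⟩
  have htend : Filter.Tendsto Φ (𝓝 (Ψ p)) (𝓝 p) := by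
    have := hΦc.continuousAt.tendsto
    rwa [hΦp] at this
  have hfd : Filter.Tendsto (fun y => fderiv ℝ Ψ (Φ y)) (𝓝 (Ψ p))
      (𝓝 ((ContinuousLinearEquiv.refl ℝ E : E ≃L[ℝ] E) : E →L[ℝ] E)) := by
    have h1 := hΨ.continuousAt_fderiv_one.tendsto
    rw [hid] at h1
    exact h1.comp htend
  have hinv : ∀ᶠ y in 𝓝 (Ψ p), fderiv ℝ Φ y = ContinuousLinearMap.inverse (fderiv ℝ Ψ (Φ y)) := by
    filter_upwards [hr.eventually_nhds, hΦc.eventually (by simp), htend.eventually_mem hU,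
      hfd.eventually_mem (ContinuousLinearEquiv.nhds _)] with y hy hyc hyU ⟨e, he⟩
    have h1 : HasFDerivAt (fun y => Ψ (Φ y)) ((fderiv ℝ Ψ (Φ y)).comp (fderiv ℝ Φ y)) y :=
      (hdiff _ hyU).hasFDerivAt.comp y (hyc.differentiableAt one_ne_zero).hasFDerivAt
    have h2 : HasFDerivAt (fun y => Ψ (Φ y)) (ContinuousLinearMap.id ℝ E) y :=
      (hasFDerivAt_id y).congr_of_eventuallyEq hy
    have h3 := h1.unique h2
    rw [← he] at h3 ⊢
    rw [ContinuousLinearMap.inverse_equiv]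
    ext v
    have := congrArg (fun L : E →L[ℝ] E => e.symm (L v)) h3
    simpa using this
  -- Near `Ψ p`, `dΦ = inverse ∘ dΨ ∘ Φ`: inversion is Lipschitz near the identity, `dΨ` is
  -- `ε`-Hölder and `Φ` is Lipschitz, so the exponent `ε` survives.
  obtain ⟨K₁, t₁, ht₁, hK₁⟩ := (contDiffAt_map_inverse (𝕜 := ℝ) (n := 1)
    (ContinuousLinearEquiv.refl ℝ E : E ≃L[ℝ] E)).exists_lipschitzOnWith
  obtain ⟨K₂, t₂, ht₂, hK₂⟩ := hΦc.exists_lipschitzOnWith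
  have ht : {y | y ∈ t₂ ∧ Φ y ∈ U ∧ fderiv ℝ Ψ (Φ y) ∈ t₁ ∧
      fderiv ℝ Φ y = ContinuousLinearMap.inverse (fderiv ℝ Ψ (Φ y))} ∈ 𝓝 (Ψ p) := by
    filter_upwards [ht₂, htend.eventually_mem hU, hfd.eventually_mem ht₁, hinv] with y h1 h2 h3 h4
      using ⟨h1, h2, h3, h4⟩
  have hc := (holderOnWith_one.2 hK₁).comp (hC.comp ((holderOnWith_one.2 hK₂).mono
    (fun y hy => hy.1)) (fun y hy => hy.2.1)) (fun y hy => hy.2.2.1) (s := {y | y ∈ t₂ ∧ Φ y ∈ U ∧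
      fderiv ℝ Ψ (Φ y) ∈ t₁ ∧ fderiv ℝ Φ y = ContinuousLinearMap.inverse (fderiv ℝ Ψ (Φ y))})
  rw [mul_one, one_mul] at hc
  exact ⟨_, _, ht, fun x hx y hy => by rw [hx.2.2.2, hy.2.2.2]; exact hc x hx y hy⟩

/-- A function which is of class `C^{1,ε}` near `q` agrees near `q` with a function which is
globally of class `C^{1,ε}`. -/
theorem exists_extension_holder_fderiv [HasContDiffBump E] [FiniteDimensional ℝ E] {g : E → ℝ}
    {q : E} {C : ℝ≥0} {t : Set E} (hε : ε < 1)
    (ht : t ∈ 𝓝 q) (hg : ContDiffAt ℝ 1 g q) (hC : HolderOnWith C ε (fderiv ℝ g) t) :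
    ∃ g₁ : E → ℝ, ContDiff ℝ 1 g₁ ∧ MemHolderSpace ε (fderiv ℝ g₁) ∧ g₁ =ᶠ[𝓝 q] g := by
  obtain ⟨K, s, hs, hK⟩ := hg.exists_lipschitzOnWith
  have hev : ∀ᶠ x in 𝓝 q, x ∈ t ∧ x ∈ s ∧ ContDiffAt ℝ 1 g x ∧ ‖g x‖ < ‖g q‖ + 1 ∧
      ‖fderiv ℝ g x‖ < ‖fderiv ℝ g q‖ + 1 := by
    filter_upwards [ht, hs, hg.eventually (by simp),
      hg.continuousAt.norm.eventually_lt_const (lt_add_one _),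
      hg.continuousAt_fderiv_one.norm.eventually_lt_const (lt_add_one _)] with x h1 h2 h3 h4 h5
      using ⟨h1, h2, h3, h4, h5⟩
  obtain ⟨r, hr, hball⟩ := Metric.eventually_nhds_iff_ball.1 hev
  -- The outer radius stays below `r`, which leaves the gap needed to pass from a Hölder bound on
  -- the ball to a global one.
  let η : ContDiffBump q := ⟨r / 3, r / 2, by linarith, by linarith⟩
  have hη1 : ContDiff ℝ 1 η := η.contDiff
  have hη2 : ContDiff ℝ 1 (fderiv ℝ η) := η.contDiff (n := 2).fderiv_right (by norm_num)
  have hηs : HasCompactSupport (η : E → ℝ) := η.hasCompactSupport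
  have hloc : ∀ x, x ∉ Metric.closedBall q (r / 2) → (fun y => η y * g y) =ᶠ[𝓝 x] fun _ => 0 := by
    intro x hx
    filter_upwards [Metric.isClosed_closedBall.isOpen_compl.mem_nhds hx] with y hy
    rw [η.zero_of_le_dist, zero_mul]
    simp only [Set.mem_compl_iff, Metric.mem_closedBall, not_le] at hy
    exact hy.le
  have hfd : ∀ x ∈ Metric.ball q r,
      fderiv ℝ (fun y => η y * g y) x = η x • fderiv ℝ g x + g x • fderiv ℝ η x := fun x hx =>
    fderiv_fun_mul (hη1.differentiable one_ne_zero x)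
      ((hball x hx).2.2.1.differentiableAt one_ne_zero)
  have hsub : MemHolderSpace ε (fun x : Metric.ball q r =>
      η x • fderiv ℝ g x + g x • fderiv ℝ η x) := by
    have val := LipschitzWith.subtype_val (Metric.ball q r)
    have e1 := (hη1.memHolderSpace_of_hasCompactSupport hηs hε).comp_lipschitz val
    have e2 := (hη2.memHolderSpace_of_hasCompactSupport (hηs.fderiv ℝ) hε).comp_lipschitz val
    have e3 : MemHolderSpace ε (fun x : Metric.ball q r => g x) :=
      LipschitzWith.memHolderSpace (K := K)
        (lipschitzOnWith_iff_restrict.1 (hK.mono fun x hx => (hball x hx).2.1)) hε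
        ⟨_, fun x => (hball x x.2).2.2.2.1.le⟩
    have e4 : MemHolderSpace ε (fun x : Metric.ball q r => fderiv ℝ g x) :=
      ⟨⟨_, fun x => (hball x x.2).2.2.2.2.le⟩, C,
        HolderWith.restrict_iff.2 (hC.mono fun x hx => (hball x hx).1)⟩
    exact (e1.smul e4).add (e3.smul e2)
  obtain ⟨⟨M, hM⟩, C', hC'⟩ := hsub
  have h0 : ∀ x, x ∉ Metric.closedBall q (r / 2) → fderiv ℝ (fun y => η y * g y) x = 0 := by
    intro x hx
    rw [(hloc x hx).fderiv_eq]
    simp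
  refine ⟨fun x => η x * g x, ?_, ?_, ?_⟩
  · rw [contDiff_iff_contDiffAt]
    intro x
    by_cases hx : x ∈ Metric.ball q r
    · exact hη1.contDiffAt.mul (hball x hx).2.2.1
    · refine contDiffAt_const.congr_of_eventuallyEq (hloc x fun h => hx ?_)
      exact Metric.closedBall_subset_ball (by linarith) h
  · refine memHolderSpace_of_eq_zero_off_ball (q := q) (r := r) (s := r / 2) (M := M ⊔ 0)
      (C := C') (by linarith) ?_ ?_ h0
    · intro x
      by_cases hx : x ∈ Metric.ball q r
      · rw [hfd x hx]
        exact (hM ⟨x, hx⟩).trans (le_max_left _ _)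
      · rw [h0 x fun h => hx (Metric.closedBall_subset_ball (by linarith) h), norm_zero]
        exact le_max_right _ _
    · intro x hx y hy
      rw [hfd x hx, hfd y hy]
      exact hC' ⟨x, hx⟩ ⟨y, hy⟩
  · filter_upwards [η.eventuallyEq_one] with x hx
    simp only [hx, Pi.one_apply, one_mul]

/-- The projection along `ν` onto the kernel of `l`, when `l ν = 1`. -/
noncomputable def projAlong (l : E →L[ℝ] ℝ) (ν : E) : E →L[ℝ] E :=
  ContinuousLinearMap.id ℝ E - l.smulRight ν

theorem projAlong_apply (l : E →L[ℝ] ℝ) (ν x : E) : projAlong l ν x = x - l x • ν := rfl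

theorem apply_projAlong {l : E →L[ℝ] ℝ} {ν : E} (h : l ν = 1) (x : E) :
    l (projAlong l ν x) = 0 := by
  simp [projAlong_apply, h]

theorem projAlong_self {l : E →L[ℝ] ℝ} {ν : E} (h : l ν = 1) : projAlong l ν ν = 0 := by
  simp [projAlong_apply, h]

theorem projAlong_projAlong {l : E →L[ℝ] ℝ} {ν : E} (h : l ν = 1) (x : E) :
    projAlong l ν (projAlong l ν x) = projAlong l ν x := by
  rw [projAlong_apply l ν (projAlong l ν x), apply_projAlong h]
  simp

theorem fderiv_apply_eq_zero_of_invariant {γ : E → ℝ} (hγ : ContDiff ℝ 1 γ) {l : E →L[ℝ] ℝ} {ν : E}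
    (hl : l ν = 1) (hinv : ∀ x, γ (projAlong l ν x) = γ x) (x : E) : fderiv ℝ γ x ν = 0 := by
  have h1 : HasFDerivAt (fun x => γ (projAlong l ν x))
      ((fderiv ℝ γ (projAlong l ν x)).comp (projAlong l ν)) x :=
    (hγ.differentiable one_ne_zero _).hasFDerivAt.comp x (projAlong l ν).hasFDerivAt
  simp only [hinv] at h1
  rw [h1.fderiv, ContinuousLinearMap.comp_apply, projAlong_self hl, map_zero]

theorem invariant_add_smul {γ : E → ℝ} {l : E →L[ℝ] ℝ} {ν : E}
    (hl : l ν = 1) (hinv : ∀ x, γ (projAlong l ν x) = γ x) (x : E) (t : ℝ) :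
    γ (x + t • ν) = γ x := by
  rw [← hinv, map_add, map_smul, projAlong_self hl, smul_zero, add_zero, hinv]

/-- A regular level set of a function of class `C^{1,ε}` is locally the graph of a function of
class `C^{1,ε}`; the latter is defined on the whole space and invariant along `ν`. -/
theorem exists_graph_of_level_set [HasContDiffBump E] [FiniteDimensional ℝ E] (hε : ε < 1)
    {H : E → ℝ} {U : Set E} {p : E} {C : ℝ≥0} (hU : IsOpen U) (hp : p ∈ U)
    (hH : ContDiffOn ℝ 1 H U) (hC : HolderOnWith C ε (fderiv ℝ H) U) (hHp : H p = 0)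
    (hdH : fderiv ℝ H p ≠ 0) :
    ∃ (l : E →L[ℝ] ℝ) (ν : E) (γ : E → ℝ), l ν = 1 ∧ ContDiff ℝ 1 γ ∧
      MemHolderSpace ε (fderiv ℝ γ) ∧ (∀ x, γ (projAlong l ν x) = γ x) ∧
      ∀ᶠ x in 𝓝 p, (H x = 0 ↔ l x = γ x) := by
  obtain ⟨w, hw⟩ : ∃ w, fderiv ℝ H p w ≠ 0 := by
    by_contra! h
    exact hdH (ContinuousLinearMap.ext h)
  set l := fderiv ℝ H p with hl
  set ν := (l w)⁻¹ • w with hν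
  have hlν : l ν = 1 := by simp [hν, inv_mul_cancel₀ hw]
  set P := projAlong l ν with hP
  have hHx : ∀ x ∈ U, DifferentiableAt ℝ H x := fun x hx =>
    (hH.contDiffAt (hU.mem_nhds hx)).differentiableAt one_ne_zero
  -- The coordinate along `ν` is replaced by `H`. The normalization `l ν = 1` makes `dΨ p` the
  -- identity, and `H x = 0` means `Ψ x = P x`; so the level set is `x = Φ (P x)` and its height is
  -- `l ∘ Φ ∘ P`.
  let Ψ : E → E := fun x => P x + H x • ν
  have hΨd : ∀ x ∈ U, HasFDerivAt Ψ (P + (fderiv ℝ H x).smulRight ν) x := fun x hx =>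
    P.hasFDerivAt.add ((hHx x hx).hasFDerivAt.smul_const ν)
  have hΨp : Ψ p = P p := by simp [Ψ, hHp]
  have hΨC : HolderOnWith (‖ν‖₊ * C) ε (fderiv ℝ Ψ) U := by
    have lip : LipschitzWith ‖ν‖₊ (fun A : E →L[ℝ] ℝ => P + A.smulRight ν) := by
      refine LipschitzWith.of_dist_le_mul fun A B => ?_
      have : A.smulRight ν - B.smulRight ν = (A - B).smulRight ν := by ext; simp [sub_smul]
      rw [dist_add_left, dist_eq_norm, this, ContinuousLinearMap.norm_smulRight_apply, mul_comm,
        dist_eq_norm, coe_nnnorm]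
    have hc := (holderWith_one.2 lip).comp_holderOnWith hC
    rw [one_mul, NNReal.coe_one, NNReal.rpow_one] at hc
    intro x hx y hy
    rw [(hΨd x hx).fderiv, (hΨd y hy).fderiv]
    exact hc x hx y hy
  have hΨid : fderiv ℝ Ψ p = ContinuousLinearMap.id ℝ E := by
    rw [(hΨd p hp).fderiv, hP, projAlong, sub_add_cancel]
  have hΨc : ContDiffAt ℝ 1 Ψ p :=
    P.contDiff.contDiffAt.add ((hH.contDiffAt (hU.mem_nhds hp)).smul contDiffAt_const)
  obtain ⟨Φ, hΦp, hΦc, hr, hlft, C', t, ht, hC'⟩ := exists_local_inverse_holder_fderiv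
    (hU.mem_nhds hp) hΨc (fun x hx => (hΨd x hx).differentiableAt) hΨC hΨid
  rw [hΨp] at hΦp hΦc hr ht
  have hΦl : ContDiffAt ℝ 1 (fun y => l (Φ y)) (P p) := l.contDiff.contDiffAt.comp _ hΦc
  have ht' : t ∩ {y | DifferentiableAt ℝ Φ y} ∈ 𝓝 (P p) := by
    filter_upwards [ht, hΦc.eventually (by simp)] with y h1 h2
      using ⟨h1, h2.differentiableAt one_ne_zero⟩
  have hΦC : HolderOnWith (‖ContinuousLinearMap.compL ℝ E E ℝ l‖₊ * C') ε
      (fderiv ℝ (fun y => l (Φ y))) (t ∩ {y | DifferentiableAt ℝ Φ y}) := by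
    have hc := (holderWith_one.2
      (ContinuousLinearMap.compL ℝ E E ℝ l).lipschitz).comp_holderOnWith hC'
    rw [one_mul, NNReal.coe_one, NNReal.rpow_one] at hc
    have key : ∀ y ∈ t ∩ {y | DifferentiableAt ℝ Φ y},
        fderiv ℝ (fun y => l (Φ y)) y = ContinuousLinearMap.compL ℝ E E ℝ l (fderiv ℝ Φ y) :=
      fun y hy => (l.hasFDerivAt.comp y hy.2.hasFDerivAt).fderiv
    intro x hx y hy
    rw [key x hx, key y hy]
    exact hc x hx.1 y hy.1
  obtain ⟨γ₁, hγ₁, hγ₁C, hγ₁e⟩ := exists_extension_holder_fderiv hε ht' hΦl hΦC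
  refine ⟨l, ν, fun x => γ₁ (P x), hlν, hγ₁.comp P.contDiff, ?_, fun x => ?_, ?_⟩
  · have : fderiv ℝ (fun x => γ₁ (P x)) =
        fun x => (ContinuousLinearMap.compL ℝ E E ℝ).flip P (fderiv ℝ γ₁ (P x)) := by
      funext x
      exact (((hγ₁.differentiable one_ne_zero) (P x)).hasFDerivAt.comp x P.hasFDerivAt).fderiv
    rw [this]
    exact (hγ₁C.comp_lipschitz P.lipschitz).clm _
  · simp only [hP, projAlong_projAlong hlν]
  · have hPt : Filter.Tendsto P (𝓝 p) (𝓝 (P p)) := P.continuous.continuousAt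
    filter_upwards [hlft, hPt.eventually hγ₁e, hPt.eventually hr] with x h1 h2 h3
    rw [h2]
    constructor
    · intro hx
      have : Ψ x = P x := by simp [Ψ, hx]
      rw [← this, h1]
    -- Equal heights give only `Φ (P x) + H (Φ (P x)) • ν = x`; applying `l` removes the second
    -- term.
    · intro hx
      have h4 : Φ (P x) + H (Φ (P x)) • ν = x := by
        have h5 : Φ (P x) - l (Φ (P x)) • ν + H (Φ (P x)) • ν = x - l x • ν := h3
        rw [← hx] at h5
        rwa [sub_add_eq_add_sub, sub_left_inj] at h5
      have h7 : H (Φ (P x)) = 0 := by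
        have := congrArg l h4
        rw [map_add, map_smul, hlν, ← hx] at this
        simpa using this
      rw [h7, zero_smul, add_zero] at h4
      rwa [h4] at h7

end

/-! ### Mollification, weak derivatives and the shear -/

section

open scoped Convolution
open ContinuousLinearMap (lsmul)

variable {E F : Type*} [NormedAddCommGroup E] [NormedSpace ℝ E] [FiniteDimensional ℝ E]
  [MeasurableSpace E] [BorelSpace E] [NormedAddCommGroup F] [NormedSpace ℝ F] [CompleteSpace F]
  {μ : Measure E} [μ.IsAddHaarMeasure]

theorem normed_convolution_eq_zero {φ : ContDiffBump (0 : E)} (hφ : φ.rOut ≤ 1) {g : E → F}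
    (hg : Continuous g) {x : E} (hx : x ∉ Metric.cthickening 1 (tsupport g)) :
    (φ.normed μ ⋆[lsmul ℝ ℝ, μ] g) x = 0 := by
  have h0 : ∀ y ∈ Metric.ball x 1, g y = 0 := by
    intro y hy
    by_contra hne
    refine hx (Metric.mem_cthickening_of_dist_le x y 1 _ (subset_tsupport _ hne) ?_)
    rw [dist_comm]
    exact (Metric.mem_ball.1 hy).le
  have hgx := h0 x (Metric.mem_ball_self one_pos)
  -- Oscillation `0` on the ball forces the mollified value to equal `g x = 0`.
  have := φ.dist_normed_convolution_le (μ := μ) (x₀ := x) (ε := 0) hg.aestronglyMeasurable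
    fun y hy => by rw [h0 y (Metric.ball_subset_ball hφ hy), hgx, dist_self]
  rw [hgx] at this
  exact dist_le_zero.1 this

theorem hasCompactSupport_normed_convolution {φ : ContDiffBump (0 : E)} (hφ : φ.rOut ≤ 1)
    {g : E → F} (hg : Continuous g) (hgs : HasCompactSupport g) :
    HasCompactSupport (φ.normed μ ⋆[lsmul ℝ ℝ, μ] g : E → F) :=
  HasCompactSupport.intro (IsCompact.cthickening hgs) fun _ hx =>
    normed_convolution_eq_zero hφ hg hx

/-- Integrals against a continuous density pass to the limit under mollification. -/
theorem tendsto_integral_normed_convolution {φ : ℕ → ContDiffBump (0 : E)}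
    (hφ : ∀ n, (φ n).rOut ≤ 1) (hφ0 : Filter.Tendsto (fun n => (φ n).rOut) .atTop (𝓝 0)) {g : E → F}
    (hg : Continuous g) (hgs : HasCompactSupport g) {T : E → F →L[ℝ] ℝ} (hT : Continuous T) :
    Filter.Tendsto (fun n => ∫ x, T x (((φ n).normed μ ⋆[lsmul ℝ ℝ, μ] g) x) ∂μ) .atTop
      (𝓝 (∫ x, T x (g x) ∂μ)) := by
  set K := Metric.cthickening 1 (tsupport g) with hK
  have hKc : IsCompact K := IsCompact.cthickening hgs
  obtain ⟨M, hM⟩ := hgs.exists_bound_of_continuous hg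
  obtain ⟨D, hD⟩ := hKc.exists_bound_of_continuousOn hT.continuousOn
  have hcont : ∀ n, Continuous ((φ n).normed μ ⋆[lsmul ℝ ℝ, μ] g : E → F) := fun n =>
    (HasCompactSupport.contDiff_convolution_left (n := 0) (lsmul ℝ ℝ)
      (φ n).hasCompactSupport_normed (φ n).contDiff_normed hg.locallyIntegrable).continuous
  -- All mollifiers have radius at most `1`, so `K` contains every support; `2 * M` bounds the
  -- oscillation of `g`, hence the distance from the mollification to `g`.
  refine tendsto_integral_of_dominated_convergence (K.indicator fun _ => D * (M + 2 * M))
    (fun n => (hT.clm_apply (hcont n)).aestronglyMeasurable) ?_ ?_ ?_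
  · exact (integrable_indicator_iff hKc.measurableSet).2
      (integrableOn_const hKc.measure_lt_top.ne)
  · refine fun n => Filter.Eventually.of_forall fun x => ?_
    by_cases hx : x ∈ K
    · rw [Set.indicator_of_mem hx]
      have h1 := (φ n).dist_normed_convolution_le (μ := μ) (x₀ := x) (ε := 2 * M)
        hg.aestronglyMeasurable fun y _ =>
          (dist_le_norm_add_norm _ _).trans (by linarith [hM x, hM y])
      have h2 : ‖((φ n).normed μ ⋆[lsmul ℝ ℝ, μ] g) x‖ ≤ M + 2 * M := by
        rw [dist_eq_norm] at h1
        exact (norm_le_norm_add_norm_sub' _ (g x)).trans (add_le_add (hM x) h1)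
      exact ((T x).le_opNorm _).trans (mul_le_mul (hD x hx) h2 (norm_nonneg _)
        ((norm_nonneg _).trans (hD x hx)))
    · rw [Set.indicator_of_notMem hx, normed_convolution_eq_zero (hφ n) hg hx, map_zero, norm_zero]
  · exact Filter.Eventually.of_forall fun x => ((T x).continuous.tendsto _).comp
      (ContDiffBump.convolution_tendsto_right_of_continuous hφ0 hg x)

/-- The weak formulation `∫ d ψ = -∫ dψ(Y)` extends from smooth to `C^1` test functions. -/
theorem weak_divergence_contDiff_one {Y : E → E} {d : E → ℝ} (hY : Continuous Y)
    (hd : Continuous d)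
    (h : ∀ ψ : E → ℝ, ContDiff ℝ ∞ ψ → HasCompactSupport ψ →
      ∫ x, d x * ψ x ∂μ = - ∫ x, fderiv ℝ ψ x (Y x) ∂μ)
    {ψ : E → ℝ} (hψ : ContDiff ℝ 1 ψ) (hψs : HasCompactSupport ψ) :
    ∫ x, d x * ψ x ∂μ = - ∫ x, fderiv ℝ ψ x (Y x) ∂μ := by
  let φ : ℕ → ContDiffBump (0 : E) := fun n =>
    ⟨1 / (n + 1) / 2, 1 / (n + 1), by positivity, half_lt_self (by positivity)⟩
  have hφ : ∀ n, (φ n).rOut ≤ 1 := fun n => by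
    change (1 : ℝ) / (n + 1) ≤ 1
    rw [div_le_one (by positivity)]
    linarith [n.cast_nonneg (α := ℝ)]
  have hφ0 : Filter.Tendsto (fun n => (φ n).rOut) .atTop (𝓝 0) :=
    tendsto_one_div_add_atTop_nhds_zero_nat
  have hfd := hψ.continuous_fderiv one_ne_zero
  have h1 := tendsto_integral_normed_convolution (μ := μ) hφ hφ0 hψ.continuous hψs
    (T := fun x => d x • ContinuousLinearMap.id ℝ ℝ) (by fun_prop)
  have h2 := tendsto_integral_normed_convolution (μ := μ) hφ hφ0 hfd (hψs.fderiv ℝ)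
    (T := fun x => ContinuousLinearMap.apply ℝ ℝ (Y x))
    ((ContinuousLinearMap.apply ℝ ℝ).continuous.comp hY)
  -- The derivative is put on `ψ`, so that it converges as the mollification of the continuous
  -- function `dψ`.
  have hconv : ∀ n x, fderiv ℝ ((φ n).normed μ ⋆[lsmul ℝ ℝ, μ] ψ : E → ℝ) x =
      ((φ n).normed μ ⋆[lsmul ℝ ℝ, μ] (fderiv ℝ ψ)) x := fun n x =>
    (hψs.hasFDerivAt_convolution_right (lsmul ℝ ℝ)
      ((φ n).continuous_normed.locallyIntegrable (μ := μ)) hψ x).fderiv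
  refine tendsto_nhds_unique h1 (h2.neg.congr fun n => ?_)
  have := h ((φ n).normed μ ⋆[lsmul ℝ ℝ, μ] ψ : E → ℝ)
    (HasCompactSupport.contDiff_convolution_left (lsmul ℝ ℝ)
      (φ n).hasCompactSupport_normed (φ n).contDiff_normed hψ.continuous.locallyIntegrable)
    (hasCompactSupport_normed_convolution (hφ n) hψ.continuous hψs)
  simp only [hconv] at this
  exact this.symm

/-- If `k` is the derivative of `u` along `v` in the weak sense, then increments of `u` along `v`
are controlled by the values of `k`. -/
theorem abs_sub_sub_le_of_weak_lineDeriv {u k : E → ℝ} (hu : UniformContinuous u)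
    (hk : UniformContinuous k) {v : E}
    (h : ∀ ψ : E → ℝ, ContDiff ℝ 1 ψ → HasCompactSupport ψ →
      ∫ x, k x * ψ x ∂μ = - ∫ x, u x * fderiv ℝ ψ x v ∂μ)
    {z : E} {a c : ℝ} (hc : ∀ s ∈ Set.Icc (0 : ℝ) 1, |k (z + s • v) - a| ≤ c) :
    |u (z + v) - u z - a| ≤ c := by
  refine le_of_forall_pos_le_add fun δ hδ => ?_
  obtain ⟨r₁, hr₁, h₁⟩ := Metric.uniformContinuous_iff.1 hu (δ / 3) (by positivity)
  obtain ⟨r₂, hr₂, h₂⟩ := Metric.uniformContinuous_iff.1 hk (δ / 3) (by positivity)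
  set r := min r₁ r₂ with hr
  have hr0 : 0 < r := lt_min hr₁ hr₂
  let φ : ContDiffBump (0 : E) := ⟨r / 2, r, by positivity, half_lt_self hr0⟩
  have hφr : φ.rOut = r := rfl
  set η := φ.normed μ with hη
  have hη1 : ContDiff ℝ 1 η := φ.contDiff_normed
  have hηs : HasCompactSupport η := φ.hasCompactSupport_normed
  have hU : ∀ x, |(η ⋆[lsmul ℝ ℝ, μ] u) x - u x| ≤ δ / 3 := fun x =>
    φ.dist_normed_convolution_le hu.continuous.aestronglyMeasurable fun y hy =>
      (h₁ ((Metric.mem_ball.1 hy).trans_le (min_le_left _ _))).le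
  have hK : ∀ x, |(η ⋆[lsmul ℝ ℝ, μ] k) x - k x| ≤ δ / 3 := fun x =>
    φ.dist_normed_convolution_le hk.continuous.aestronglyMeasurable fun y hy =>
      (h₂ ((Metric.mem_ball.1 hy).trans_le (min_le_right _ _))).le
  -- The weak identity tested on `t ↦ η (x - t)` is the classical identity `∂_v (η ⋆ u) = η ⋆ k`.
  -- The mean value theorem then applies to `η ⋆ u`, and the three mollification errors of `δ / 3`
  -- add up to `δ`.
  have hder : ∀ x, HasLineDerivAt ℝ (η ⋆[lsmul ℝ ℝ, μ] u) ((η ⋆[lsmul ℝ ℝ, μ] k) x) x v := by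
    intro x
    have hd := hηs.hasFDerivAt_convolution_right (μ := μ) (lsmul ℝ ℝ).flip
      hu.continuous.locallyIntegrable hη1 x
    rw [convolution_flip] at hd
    convert hd.hasLineDerivAt v using 1
    rw [convolution_precompR_apply _ hu.continuous.locallyIntegrable (hηs.fderiv ℝ)
      (hη1.continuous_fderiv one_ne_zero), convolution_lsmul_swap, convolution_def]
    have hψ : ContDiff ℝ 1 fun t => η (x - t) := by fun_prop
    have hψs : HasCompactSupport fun t => η (x - t) :=
      hηs.comp_homeomorph (Homeomorph.subLeft x)
    have hψd : ∀ t, fderiv ℝ (fun t => η (x - t)) t v = - fderiv ℝ η (x - t) v := fun t => by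
      have := (hη1.differentiable one_ne_zero (x - t)).hasFDerivAt.comp t
        ((hasFDerivAt_id t).const_sub x)
      have := this.fderiv
      simp only [Function.comp_def] at this
      rw [this]
      simp
    have := h _ hψ hψs
    simp only [hψd, mul_neg, integral_neg, neg_neg] at this
    simp only [smul_eq_mul, ContinuousLinearMap.flip_apply, ContinuousLinearMap.lsmul_apply]
    simp only [mul_comm (k _)] at this
    rw [this]
    simp only [mul_comm]
  have hderiv : ∀ s : ℝ, HasDerivAt (fun s => (η ⋆[lsmul ℝ ℝ, μ] u) (z + s • v))
      ((η ⋆[lsmul ℝ ℝ, μ] k) (z + s • v)) s := by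
    intro s
    have h0 := hder (z + s • v)
    rw [HasLineDerivAt] at h0
    have h1 := HasDerivAt.scomp_of_eq s h0 ((hasDerivAt_id s).sub_const s) (by simp)
    simp only [Function.comp_def, id, one_smul] at h1
    have h2 : ∀ t : ℝ, z + s • v + (t - s) • v = z + t • v := fun t => by module
    simpa only [h2] using h1
  obtain ⟨s, hs, hs'⟩ := exists_hasDerivAt_eq_slope
    (fun s : ℝ => (η ⋆[lsmul ℝ ℝ, μ] u) (z + s • v)) _ one_pos
    (fun s _ => (hderiv s).continuousAt.continuousWithinAt) (fun s _ => hderiv s)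
  simp only [one_smul, zero_smul, add_zero, sub_zero, div_one] at hs'
  have e1 := hU (z + v)
  have e2 := hU z
  have e3 := hK (z + s • v)
  have e4 := hc s ⟨hs.1.le, hs.2.le⟩
  rw [abs_le] at *
  constructor <;> linarith [e1.1, e1.2, e2.1, e2.2, e3.1, e3.2, e4.1, e4.2]

/-- The shear `x ↦ x + γ(x) ν` preserves integrals when `γ` is invariant along `ν`. -/
theorem integral_comp_shear {γ : E → ℝ} (hγ : ContDiff ℝ 1 γ) {l : E →L[ℝ] ℝ} {ν : E}
    (hl : l ν = 1) (hinv : ∀ x, γ (projAlong l ν x) = γ x) (g : E → ℝ) :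
    ∫ x, g (x + γ x • ν) ∂μ = ∫ x, g x ∂μ := by
  have hd : ∀ x ∈ Set.univ, HasFDerivWithinAt (fun x => x + γ x • ν)
      (ContinuousLinearMap.id ℝ E + (fderiv ℝ γ x).smulRight ν) Set.univ x := fun x _ =>
    ((hasFDerivAt_id x).add
      ((hγ.differentiable one_ne_zero x).hasFDerivAt.smul_const ν)).hasFDerivWithinAt
  have hinj : Set.InjOn (fun x => x + γ x • ν) Set.univ := by
    intro x _ y _ hxy
    simp only at hxy
    have h1 : γ x = γ y := by
      rw [← invariant_add_smul hl hinv x (γ x), hxy, invariant_add_smul hl hinv]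
    rwa [h1, add_left_inj] at hxy
  have hsurj : (fun x => x + γ x • ν) '' Set.univ = Set.univ := by
    refine Set.eq_univ_of_forall fun y => ⟨y + (-γ y) • ν, trivial, ?_⟩
    simp only [invariant_add_smul hl hinv]
    module
  -- The differential is a transvection, of determinant `1 + dγ(ν)`, and `dγ(ν) = 0`.
  have hdet : ∀ x, (ContinuousLinearMap.id ℝ E + (fderiv ℝ γ x).smulRight ν).det = 1 := by
    intro x
    have : ((ContinuousLinearMap.id ℝ E + (fderiv ℝ γ x).smulRight ν : E →L[ℝ] E) : E →ₗ[ℝ] E) =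
        LinearMap.transvection (fderiv ℝ γ x : E →ₗ[ℝ] ℝ) ν := by
      ext v
      simp [LinearMap.transvection]
    rw [ContinuousLinearMap.det, this, LinearMap.transvection.det]
    simp [fderiv_apply_eq_zero_of_invariant hγ hl hinv]
  have := integral_image_eq_integral_abs_det_fderiv_smul μ MeasurableSet.univ hd hinj g
  rw [hsurj] at this
  simpa [hdet] using this.symm

end

/-! ### Fields tangent to the graphs -/

section

variable {E : Type*} [NormedAddCommGroup E] [NormedSpace ℝ E]

/-- The field `χ (v' + dγ(v) ν)`, with `v'` the projection of `v`, which is tangent to the graphs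
`l = γ + c`. -/
noncomputable def graphField (l : E →L[ℝ] ℝ) (ν : E) (γ χ : E → ℝ) (v x : E) : E :=
  χ x • (projAlong l ν v + fderiv ℝ γ x v • ν)

variable {l : E →L[ℝ] ℝ} {ν : E} {γ χ : E → ℝ}

/-- Functions vanishing on the graph `l = γ` are annihilated by `graphField`. -/
theorem fderiv_apply_graphField_eq_zero (hl : l ν = 1) (hγ : ContDiff ℝ 1 γ)
    (hinv : ∀ x, γ (projAlong l ν x) = γ x) {H : E → ℝ} {x : E} (hH : DifferentiableAt ℝ H x)
    (hx : l x = γ x) (h0 : ∀ᶠ y in 𝓝 x, l y = γ y → H y = 0) (v : E) :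
    fderiv ℝ H x (graphField l ν γ χ v x) = 0 := by
  set w := projAlong l ν v with hw
  have hdw : fderiv ℝ γ x w = fderiv ℝ γ x v := by
    rw [hw, projAlong_apply, map_sub, map_smul, fderiv_apply_eq_zero_of_invariant hγ hl hinv,
      smul_zero, sub_zero]
  -- This curve stays on the graph and has velocity `w + dγ(w) ν` at `0`; `H` vanishes along it.
  let c : ℝ → E := fun s => x + s • w + (γ (x + s • w) - γ x) • ν
  have hc0 : c 0 = x := by simp [c]
  have hline : HasDerivAt (fun s : ℝ => x + s • w) w 0 := by
    simpa using ((hasDerivAt_id (0 : ℝ)).smul_const w).const_add x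
  have hγc : HasDerivAt (fun s : ℝ => γ (x + s • w)) (fderiv ℝ γ x w) 0 :=
    (hγ.differentiable one_ne_zero x).hasFDerivAt.comp_hasDerivAt_of_eq 0 hline (by simp)
  have hc : HasDerivAt c (w + fderiv ℝ γ x w • ν) 0 :=
    hline.add ((hγc.sub_const _).smul_const ν)
  have hHc : HasDerivAt (fun s => H (c s)) (fderiv ℝ H x (w + fderiv ℝ γ x w • ν)) 0 :=
    hH.hasFDerivAt.comp_hasDerivAt_of_eq 0 hc hc0.symm
  have hgraph : ∀ s, l (c s) = γ (c s) := fun s => by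
    simp only [c, invariant_add_smul hl hinv]
    simp [hl, hx, hw, apply_projAlong hl]
  have hzero : (fun s => H (c s)) =ᶠ[𝓝 0] fun _ => 0 := by
    have htend : Filter.Tendsto c (𝓝 0) (𝓝 x) := by
      have := hc.continuousAt.tendsto
      rwa [hc0] at this
    filter_upwards [htend.eventually h0] with s hs using hs (hgraph s)
  have := hHc.unique ((hasDerivAt_const (0 : ℝ) (0 : ℝ)).congr_of_eventuallyEq hzero)
  rw [graphField, map_smul, ← hw, ← hdw, this, smul_zero]

end

/-! ### Weak identities in straightened coordinates -/

section

variable {E : Type*} [NormedAddCommGroup E] [NormedSpace ℝ E] [FiniteDimensional ℝ E]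
  [MeasurableSpace E] [BorelSpace E] {μ : Measure E} [μ.IsAddHaarMeasure]

/-- The increment of `u` from `P z` to `P z + P v` differs from `K (P z) v` by at most the
oscillation of `K` on that segment times `‖v‖`, which is `o(‖v‖)` by uniform continuity. Only
derivatives of `u` along the range of `P` enter. -/
theorem hasFDerivAt_comp_of_weak_lineDeriv {u : E → ℝ} {K : E → E →L[ℝ] ℝ} {P : E →L[ℝ] E}
    (hu : UniformContinuous u) (hK : UniformContinuous K)
    (h : ∀ (v : E) (ψ : E → ℝ), ContDiff ℝ 1 ψ → HasCompactSupport ψ →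
      ∫ x, K x v * ψ x ∂μ = - ∫ x, u x * fderiv ℝ ψ x (P v) ∂μ) (z : E) :
    HasFDerivAt (fun z => u (P z)) (K (P z)) z := by
  rw [hasFDerivAt_iff_isLittleO_nhds_zero, Asymptotics.isLittleO_iff]
  intro c hc
  obtain ⟨δ, hδ, hδK⟩ := Metric.uniformContinuous_iff.1 hK c hc
  have hev : ∀ᶠ v in 𝓝 (0 : E), ‖P v‖ < δ := by
    have : Filter.Tendsto (fun v => ‖P v‖) (𝓝 0) (𝓝 0) := by
      simpa using P.continuous.norm.tendsto 0
    exact this.eventually_lt_const hδ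
  filter_upwards [hev] with v hv
  rw [Real.norm_eq_abs, map_add]
  refine abs_sub_sub_le_of_weak_lineDeriv (μ := μ) (k := fun x => K x v) hu ?_ (h v) fun s hs => ?_
  · exact (ContinuousLinearMap.apply ℝ ℝ v).uniformContinuous.comp hK
  · rw [← Real.norm_eq_abs, ← sub_apply]
    refine (ContinuousLinearMap.le_opNorm _ _).trans (mul_le_mul_of_nonneg_right ?_ (norm_nonneg _))
    rw [← dist_eq_norm]
    refine (hδK ?_).le
    rw [dist_eq_norm, add_sub_cancel_left, norm_smul, Real.norm_of_nonneg hs.1]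
    exact (mul_le_of_le_one_left (norm_nonneg _) hs.2).trans_lt hv

/-- Here `k ∂_ν ζ = ∂_ν (k ζ)`. This replaces differentiability of `k`, and is applied to `k =
dγ(v)`, which is only continuous. -/
theorem integral_mul_fderiv_eq_zero_of_invariant {k ζ : E → ℝ} {ν : E} (hk : Continuous k)
    (hinv : ∀ x (t : ℝ), k (x + t • ν) = k x) (hζ : ContDiff ℝ 1 ζ) (hζs : HasCompactSupport ζ) :
    ∫ x, k x * fderiv ℝ ζ x ν ∂μ = 0 := by
  have hfd : Continuous fun x => fderiv ℝ ζ x ν :=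
    (hζ.continuous_fderiv one_ne_zero).clm_apply continuous_const
  have hfds : HasCompactSupport fun x => fderiv ℝ ζ x ν := hζs.fderiv_apply ℝ ν
  have := integral_bilinear_hasLineDerivAt_right_eq_neg_left_of_integrable (μ := μ) (v := ν)
    (f := k) (f' := fun _ => 0) (g := ζ) (g' := fun x => fderiv ℝ ζ x ν)
    (B := ContinuousLinearMap.mul ℝ ℝ) (by simp)
    ((hk.mul hfd).integrable_of_hasCompactSupport hfds.mul_left)
    ((hk.mul hζ.continuous).integrable_of_hasCompactSupport hζs.mul_left)
    (fun x _ => by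
      simp only [HasLineDerivAt, hinv]
      exact hasDerivAt_const _ _)
    (fun x _ => (hζ.differentiable one_ne_zero x).hasFDerivAt.hasLineDerivAt ν)
  simpa using this

variable {l : E →L[ℝ] ℝ} {ν : E} {γ χ : E → ℝ}

/-- The field without cutoff is divergence free: `P v` is constant and `dγ(v)` is invariant along
`ν`. Testing this on `χ ψ` and expanding by the product rule leaves only the derivative of `χ`. -/
theorem weak_divergence_graphField (hl : l ν = 1) (hγ : ContDiff ℝ 1 γ)
    (hinv : ∀ x, γ (projAlong l ν x) = γ x) (hχ : ContDiff ℝ 1 χ) (hχs : HasCompactSupport χ)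
    (v : E) {ψ : E → ℝ} (hψ : ContDiff ℝ 1 ψ) :
    ∫ x, fderiv ℝ χ x (projAlong l ν v + fderiv ℝ γ x v • ν) * ψ x ∂μ =
      - ∫ x, fderiv ℝ ψ x (graphField l ν γ χ v x) ∂μ := by
  have hk : Continuous fun x => fderiv ℝ γ x v :=
    (hγ.continuous_fderiv one_ne_zero).clm_apply continuous_const
  have hkinv : ∀ x (t : ℝ), fderiv ℝ γ (x + t • ν) v = fderiv ℝ γ x v := fun x t => by
    rw [← fderiv_comp_add_right]
    simp only [invariant_add_smul hl hinv]
  have hζ : ContDiff ℝ 1 fun x => χ x * ψ x := hχ.mul hψ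
  have hζs : HasCompactSupport fun x => χ x * ψ x := hχs.mul_right
  have h1 := integral_mul_fderiv_eq_zero_of_invariant (μ := μ) (k := fun _ => 1)
    (ν := projAlong l ν v) continuous_const (fun _ _ => rfl) hζ hζs
  have h2 := integral_mul_fderiv_eq_zero_of_invariant (μ := μ) hk hkinv hζ hζs
  have cχ := hχ.continuous_fderiv one_ne_zero
  have cψ := hψ.continuous_fderiv one_ne_zero
  have cζ := hζ.continuous_fderiv one_ne_zero
  have cw : Continuous fun x => projAlong l ν v + fderiv ℝ γ x v • ν :=
    continuous_const.add (hk.smul continuous_const)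
  have i1 : Integrable (fun x => (1 : ℝ) * fderiv ℝ (fun x => χ x * ψ x) x (projAlong l ν v)) μ :=
    (continuous_const.mul (cζ.clm_apply continuous_const)).integrable_of_hasCompactSupport
      (hζs.fderiv_apply ℝ _).mul_left
  have i2 : Integrable (fun x => fderiv ℝ γ x v * fderiv ℝ (fun x => χ x * ψ x) x ν) μ :=
    (hk.mul (cζ.clm_apply continuous_const)).integrable_of_hasCompactSupport
      (hζs.fderiv_apply ℝ _).mul_left
  have i3 : Integrable
      (fun x => fderiv ℝ χ x (projAlong l ν v + fderiv ℝ γ x v • ν) * ψ x) μ := by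
    refine ((cχ.clm_apply cw).mul hψ.continuous).integrable_of_hasCompactSupport
      (HasCompactSupport.mul_right ((hχs.fderiv ℝ).mono fun x hx h => hx ?_))
    simp only [h, zero_apply]
  have i4 : Integrable (fun x => fderiv ℝ ψ x (graphField l ν γ χ v x)) μ := by
    refine (cψ.clm_apply (hχ.continuous.smul cw)).integrable_of_hasCompactSupport
      (hχs.mono fun x hx h => hx ?_)
    simp [h]
  rw [eq_neg_iff_add_eq_zero, ← integral_add i3 i4]
  have := integral_add i1 i2
  rw [h1, h2, add_zero] at this
  rw [← this]
  refine integral_congr_ae (Filter.Eventually.of_forall fun x => ?_)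
  have hd : fderiv ℝ (fun x => χ x * ψ x) x = χ x • fderiv ℝ ψ x + ψ x • fderiv ℝ χ x :=
    fderiv_fun_mul (hχ.differentiable one_ne_zero x) (hψ.differentiable one_ne_zero x)
  simp only [hd, graphField, map_add, map_smul, add_apply,
    smul_apply, smul_eq_mul]
  ring

/-- In the coordinates straightening the graphs `l = γ + c`, a weak divergence of `f X`, with `X`
the field `graphField`, is a weak derivative of `f χ` along a constant direction. -/
theorem weak_lineDeriv_of_weak_divergence_graphField (hl : l ν = 1) (hγ : ContDiff ℝ 1 γ)
    (hinv : ∀ x, γ (projAlong l ν x) = γ x) {f g : E → ℝ} {v : E}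
    (h : ∀ ψ : E → ℝ, ContDiff ℝ 1 ψ → HasCompactSupport ψ →
      ∫ x, g x * ψ x ∂μ = - ∫ x, fderiv ℝ ψ x (f x • graphField l ν γ χ v x) ∂μ)
    {ψ : E → ℝ} (hψ : ContDiff ℝ 1 ψ) (hψs : HasCompactSupport ψ) :
    ∫ z, g (z + γ z • ν) * ψ z ∂μ =
      - ∫ z, (f (z + γ z • ν) * χ (z + γ z • ν)) * fderiv ℝ ψ z (projAlong l ν v) ∂μ := by
  have hI : ∀ z, z + γ z • ν - γ (z + γ z • ν) • ν = z := fun z => by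
    rw [invariant_add_smul hl hinv, add_sub_cancel_right]
  have hI' : ∀ x, x - γ x • ν + γ (x - γ x • ν) • ν = x := fun x => by
    rw [sub_eq_add_neg, ← neg_smul, invariant_add_smul hl hinv]
    module
  have hψ' : ContDiff ℝ 1 fun x => ψ (x - γ x • ν) :=
    hψ.comp (contDiff_id.sub (hγ.smul contDiff_const))
  have hψs' : HasCompactSupport fun x => ψ (x - γ x • ν) := by
    have hcont : Continuous fun z => z + γ z • ν :=
      continuous_id.add (hγ.continuous.smul continuous_const)
    refine HasCompactSupport.intro (IsCompact.image hψs hcont) fun x hx => ?_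
    by_contra hne
    exact hx ⟨x - γ x • ν, subset_tsupport _ hne, hI' x⟩
  have h1 := h _ hψ' hψs'
  rw [← integral_comp_shear hγ hl hinv, ← integral_comp_shear hγ hl hinv (fun x =>
    fderiv ℝ (fun x => ψ (x - γ x • ν)) x (f x • graphField l ν γ χ v x))] at h1
  simp only [hI] at h1
  rw [h1]
  congr 2
  funext z
  set y := z + γ z • ν with hy
  -- The inverse shear has differential `id - dγ ⊗ ν`, which sends `P v + dγ(v) ν` back to `P v`.
  have hd : HasFDerivAt (fun x => ψ (x - γ x • ν)) ((fderiv ℝ ψ z).comp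
      (ContinuousLinearMap.id ℝ E - (fderiv ℝ γ y).smulRight ν)) y := by
    have hψz := (hψ.differentiable one_ne_zero z).hasFDerivAt
    rw [← hI z] at hψz
    have := hψz.comp y ((hasFDerivAt_id y).sub
      ((hγ.differentiable one_ne_zero y).hasFDerivAt.smul_const ν))
    rwa [hI z] at this
  rw [hd.fderiv]
  have hγν := fderiv_apply_eq_zero_of_invariant hγ hl hinv y
  have hγP : fderiv ℝ γ y (projAlong l ν v) = fderiv ℝ γ y v := by
    rw [projAlong_apply, map_sub, map_smul, hγν, smul_zero, sub_zero]
  simp only [graphField, ContinuousLinearMap.comp_apply, sub_apply, map_smul,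
    map_add, ContinuousLinearMap.smulRight_apply, hγν, hγP, smul_eq_mul, map_sub,
    ContinuousLinearMap.id_apply]
  ring

end

/-! ### Conormal functions near a point of the hypersurface -/

section

variable {N : ℕ} {ε : ℝ≥0} {S : Set (EuclideanSpace ℝ (Fin N))}
  {l : EuclideanSpace ℝ (Fin N) →L[ℝ] ℝ} {ν : EuclideanSpace ℝ (Fin N)}
  {γ χ : EuclideanSpace ℝ (Fin N) → ℝ}

theorem isTangentHolderField_graphField (hε : ε < 1) (hl : l ν = 1) (hγ : ContDiff ℝ 1 γ)
    (hγC : MemHolderSpace ε (fderiv ℝ γ)) (hinv : ∀ x, γ (projAlong l ν x) = γ x)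
    (hχ : ContDiff ℝ ∞ χ) (hχs : HasCompactSupport χ)
    (hS : ∀ x, χ x ≠ 0 → ∀ᶠ y in 𝓝 x, (y ∈ S ↔ l y = γ y)) (v : EuclideanSpace ℝ (Fin N)) :
    IsTangentHolderField ε S (graphField l ν γ χ v) := by
  have hχ1 : ContDiff ℝ 1 χ := hχ.of_le (by simp)
  have hχd : ContDiff ℝ 1 (fderiv ℝ χ) := 
    (contDiff_infty_iff_fderiv.1 hχ).2.of_le (by simp)
  have hw : MemHolderSpace ε fun x => projAlong l ν v + fderiv ℝ γ x v • ν :=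
    (MemHolderSpace.const _).add
      ((hγC.clm (ContinuousLinearMap.apply ℝ ℝ v)).smul (MemHolderSpace.const ν))
  refine ⟨fun i => ?_, ?_, ?_⟩
  · exact ((hχ1.memHolderSpace_of_hasCompactSupport hχs hε).smul hw).clm
      (EuclideanSpace.proj i : EuclideanSpace ℝ (Fin N) →L[ℝ] ℝ)
  · refine ⟨fun x => fderiv ℝ χ x (projAlong l ν v + fderiv ℝ γ x v • ν), ?_, ?_⟩
    · exact (hχd.memHolderSpace_of_hasCompactSupport (hχs.fderiv ℝ) hε).bilin
        (ContinuousLinearMap.id ℝ (EuclideanSpace ℝ (Fin N) →L[ℝ] ℝ)) hw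
    · intro ψ hψ _
      exact weak_divergence_graphField hl hγ hinv hχ1 hχs v (hψ.of_le (by simp))
  · intro U H hH x hx
    by_cases h0 : χ x = 0
    · simp [graphField, h0]
    · have hxS := hS x h0
      refine fderiv_apply_graphField_eq_zero hl hγ hinv ?_ (hxS.self_of_nhds.1 hx.1) ?_ v
      · exact (hH.contDiffOn.contDiffAt (hH.isOpen.mem_nhds hx.2)).differentiableAt one_ne_zero
      · filter_upwards [hxS, hH.isOpen.mem_nhds hx.2] with y hy hyU hly
        exact (hH.mem_iff y hyU).1 (hy.2 hly)

/-- A Hölder continuous conormal function coincides on `S`, near any point of `S`, with a function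
of class `C^{1,ε}` on the whole space. -/
theorem exists_local_extension_of_memConormal (hε₀ : 0 < ε) (hε₁ : ε < 1)
    (hS : IsC1HolderHypersurface ε S) {f : EuclideanSpace ℝ (Fin N) → ℝ}
    (hf : MemHolderSpace ε f) (hfS : MemConormal ε S f) {p : EuclideanSpace ℝ (Fin N)}
    (hp : p ∈ S) :
    ∃ F : EuclideanSpace ℝ (Fin N) → ℝ, ContDiff ℝ 1 F ∧ MemHolderSpace ε (fderiv ℝ F) ∧
      ∀ᶠ x in 𝓝 p, x ∈ S → F x = f x := by
  obtain ⟨U, H, hpU, hH⟩ := hS p hp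
  obtain ⟨C, hC⟩ := hH.holder_fderiv
  obtain ⟨l, ν, γ, hl, hγ, hγC, hinv, hgraph⟩ := exists_graph_of_level_set hε₁ hH.isOpen hpU
    hH.contDiffOn hC ((hH.mem_iff p hpU).1 hp) (hH.fderiv_ne_zero p ⟨hp, hpU⟩)
  have hSgraph : ∀ᶠ x in 𝓝 p, (x ∈ S ↔ l x = γ x) := by
    filter_upwards [hgraph, hH.isOpen.mem_nhds hpU] with x hx hxU
    rw [hH.mem_iff x hxU, hx]
  obtain ⟨r, hr, hball⟩ := Metric.eventually_nhds_iff_ball.1 hSgraph.eventually_nhds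
  let χ : ContDiffBump p := ⟨r / 2, r, by positivity, half_lt_self hr⟩
  have hχ : ContDiff ℝ ∞ χ := χ.contDiff
  have hχs : HasCompactSupport χ := χ.hasCompactSupport
  have htan : ∀ v, IsTangentHolderField ε S (graphField l ν γ χ v) := fun v => by
    refine isTangentHolderField_graphField hε₁ hl hγ hγC hinv hχ hχs (fun x hx => ?_) v
    refine hball x ?_
    have : x ∈ Function.support χ := hx
    rwa [χ.support_eq] at this
  -- Divergences are chosen for basis vectors only, so that `K z v` below is linear in `v` by
  -- construction.
  choose g hgC hg using fun i : Fin N => hfS.2 _ (htan (EuclideanSpace.single i 1))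
  set P := projAlong l ν with hP
  obtain ⟨Lγ, hLγ⟩ := lipschitzWith_of_memHolderSpace_fderiv hγ hγC
  have hΘ : LipschitzWith (1 + Lγ * ‖ν‖₊) fun z => z + γ z • ν := by
    refine LipschitzWith.id.add (LipschitzWith.of_dist_le_mul fun x y => ?_)
    rw [dist_eq_norm, ← sub_smul, norm_smul, NNReal.coe_mul, coe_nnnorm, mul_right_comm,
      ← dist_eq_norm]
    exact mul_le_mul_of_nonneg_right (hLγ.dist_le_mul x y) (norm_nonneg _)
  let u : EuclideanSpace ℝ (Fin N) → ℝ := fun z => f (z + γ z • ν) * χ (z + γ z • ν)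
  let K : EuclideanSpace ℝ (Fin N) → EuclideanSpace ℝ (Fin N) →L[ℝ] ℝ := fun z =>
    ∑ i, g i (z + γ z • ν) • (EuclideanSpace.proj i : EuclideanSpace ℝ (Fin N) →L[ℝ] ℝ)
  have hu : MemHolderSpace ε u := (hf.mul ((hχ.of_le (by simp) :
    ContDiff ℝ 1 χ).memHolderSpace_of_hasCompactSupport hχs hε₁)).comp_lipschitz hΘ
  have hK : MemHolderSpace ε K := MemHolderSpace.sum _ fun i _ =>
    ((hgC i).comp_lipschitz hΘ).smul (MemHolderSpace.const _)
  have huc : Continuous u := hu.continuous hε₀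
  have hweak : ∀ (v : EuclideanSpace ℝ (Fin N)) (ψ : EuclideanSpace ℝ (Fin N) → ℝ),
      ContDiff ℝ 1 ψ → HasCompactSupport ψ →
      ∫ x, K x v * ψ x = - ∫ x, u x * fderiv ℝ ψ x (P v) := by
    intro v ψ hψ hψs
    have hgf : ∀ i, Continuous (graphField l ν γ χ (EuclideanSpace.single i 1)) := fun i =>
      hχ.continuous.smul (continuous_const.add (((hγ.continuous_fderiv one_ne_zero).clm_apply
        continuous_const).smul continuous_const))
    have hi : ∀ i, ∫ z, g i (z + γ z • ν) * ψ z =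
        - ∫ z, u z * fderiv ℝ ψ z (P (EuclideanSpace.single i 1)) := fun i =>
      weak_lineDeriv_of_weak_divergence_graphField hl hγ hinv
        (fun ψ hψ hψs => weak_divergence_contDiff_one ((hf.continuous hε₀).smul (hgf i))
          ((hgC i).continuous hε₀) (hg i) hψ hψs) hψ hψs
    have hv : ∀ x, fderiv ℝ ψ x (P v) =
        ∑ i, v i * fderiv ℝ ψ x (P (EuclideanSpace.single i 1)) := fun x => by
      conv_lhs => rw [← (EuclideanSpace.basisFun (Fin N) ℝ).sum_repr v]
      simp
    have e1 : ∀ x, K x v * ψ x = ∑ i, v i * (g i (x + γ x • ν) * ψ x) := fun x => by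
      simp only [K, sum_apply, smul_apply, smul_eq_mul, Finset.sum_mul]
      exact Finset.sum_congr rfl fun i _ => by rw [PiLp.proj_apply]; ring
    have e2 : ∀ x, u x * fderiv ℝ ψ x (P v) =
        ∑ i, v i * (u x * fderiv ℝ ψ x (P (EuclideanSpace.single i 1))) := fun x => by
      rw [hv, Finset.mul_sum]
      exact Finset.sum_congr rfl fun i _ => by ring
    simp only [e1, e2]
    rw [integral_finsetSum, integral_finsetSum, ← Finset.sum_neg_distrib]
    · simp only [integral_const_mul, hi, mul_neg]
    · intro i _
      exact ((huc.mul ((hψ.continuous_fderiv one_ne_zero).clm_apply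
        continuous_const)).integrable_of_hasCompactSupport
        (hψs.fderiv_apply ℝ _).mul_left).const_mul _
    · intro i _
      exact (((((hgC i).continuous hε₀).comp hΘ.continuous).mul
        hψ.continuous).integrable_of_hasCompactSupport hψs.mul_left).const_mul _
  obtain ⟨-, Cu, hCu⟩ := id hu
  obtain ⟨-, CK, hCK⟩ := id hK
  have hF := hasFDerivAt_comp_of_weak_lineDeriv (hCu.uniformContinuous hε₀)
    (hCK.uniformContinuous hε₀) hweak
  have hFd : fderiv ℝ (fun z => u (P z)) = fun z => K (P z) := funext fun z => (hF z).fderiv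
  refine ⟨fun z => u (P z), ?_, ?_, ?_⟩
  · rw [contDiff_one_iff_fderiv, hFd]
    exact ⟨fun z => (hF z).differentiableAt, (hK.continuous hε₀).comp P.continuous⟩
  · rw [hFd]
    exact hK.comp_lipschitz P.lipschitz
  -- On the graph `γ (P x) = γ x = l x`, hence the shear takes `P x` back to `x`.
  · filter_upwards [hSgraph, χ.eventuallyEq_one] with x hx hχx hxS
    have : P x + γ (P x) • ν = x := by
      rw [hP, hinv, ← hx.1 hxS, projAlong_apply, sub_add_cancel]
    simp only [u, this, hχx, Pi.one_apply, mul_one]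

end

/-! ### Patching over the compact hypersurface -/

/-- A bounded function which locally extends, near the image of a map `φ` of class `C^{1,ε}`
contained in a compact set, to functions of class `C^{1,ε}`, is of class `C^{1,ε}` along `φ`. -/
theorem memC1HolderSpace_comp_of_local_extension {E E' : Type*} [NormedAddCommGroup E]
    [NormedSpace ℝ E] [NormedAddCommGroup E'] [NormedSpace ℝ E'] {ε : ℝ≥0} {S : Set E}
    (hS : IsCompact S) {f : E → ℝ} (hfb : ∃ M : ℝ, ∀ x, ‖f x‖ ≤ M)
    (hloc : ∀ p ∈ S, ∃ F : E → ℝ, ContDiff ℝ 1 F ∧ MemHolderSpace ε (fderiv ℝ F) ∧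
      ∀ᶠ x in 𝓝 p, x ∈ S → F x = f x)
    {φ : E' → E} (hφ : MemC1HolderSpace ε φ) (hφS : ∀ y, φ y ∈ S) :
    MemC1HolderSpace ε fun y => f (φ y) := by
  obtain ⟨hφ1, -, hφd⟩ := hφ
  obtain ⟨L, hL⟩ := lipschitzWith_of_memHolderSpace_fderiv hφ1 hφd
  choose! F hF hFd hFf using hloc
  have hnhds : ∀ p ∈ S, ∃ V : Set E, (∀ x ∈ V, x ∈ S → F p x = f x) ∧ IsOpen V ∧ p ∈ V :=
    fun p hp => eventually_nhds_iff.1 (hFf p hp)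
  choose! V hV hVo hpV using hnhds
  obtain ⟨t, htS, hcover⟩ := hS.elim_nhds_subcover V fun p hp => (hVo p hp).mem_nhds (hpV p hp)
  obtain ⟨δ, hδ, hleb⟩ := lebesgue_number_lemma_of_metric hS
    (c := fun p : t => V p) (fun p => hVo p (htS p p.2))
    (hcover.trans fun x hx => by simpa using hx)
  have hcomp : ∀ p ∈ S, MemHolderSpace ε (fderiv ℝ fun y => F p (φ y)) := by
    intro p hp
    have : fderiv ℝ (fun y => F p (φ y)) = fun y =>
        ContinuousLinearMap.compL ℝ E' E ℝ (fderiv ℝ (F p) (φ y)) (fderiv ℝ φ y) := by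
      funext y
      exact (((hF p hp).differentiable one_ne_zero _).hasFDerivAt.comp y
        (hφ1.differentiable one_ne_zero y).hasFDerivAt).fderiv
    rw [this]
    exact ((hFd p hp).comp_lipschitz hL).bilin _ hφd
  have hbound : ∀ p ∈ S, ∃ (M : ℝ) (C : ℝ≥0), (∀ y, ‖fderiv ℝ (fun y => F p (φ y)) y‖ ≤ M) ∧
      HolderWith C ε (fderiv ℝ fun y => F p (φ y)) := fun p hp =>
    let ⟨⟨M, hM⟩, C, hC⟩ := hcomp p hp
    ⟨M, C, hM, hC⟩
  choose! M C hM hC using hbound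
  have heq : ∀ p ∈ S, ∀ y, φ y ∈ V p → (fun y => f (φ y)) =ᶠ[𝓝 y] fun y => F p (φ y) := by
    intro p hp y hy
    filter_upwards [hφ1.continuous.continuousAt.preimage_mem_nhds ((hVo p hp).mem_nhds hy)]
      with y' hy'
    exact (hV p hp _ hy' (hφS y')).symm
  refine ⟨?_, hfb.imp fun M hM y => hM _, ?_⟩
  · rw [contDiff_iff_contDiffAt]
    intro y
    obtain ⟨p, hp⟩ := hleb _ (hφS y)
    exact ((hF p (htS p p.2)).comp hφ1).contDiffAt.congr_of_eventuallyEq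
      (heq p (htS p p.2) y (hp (Metric.mem_ball_self hδ)))
  -- With `δ` a Lebesgue number of the cover and `L` a Lipschitz constant of `φ`, points closer than
  -- `δ / (L + 1)` have images in a common `V p`, so a single `F p` computes both differentials.
  -- Finiteness of `t` gives the uniform constants.
  · refine memHolderSpace_of_small_scale (M := (t.sup fun p => (M p).toNNReal : ℝ≥0))
      (C := (t.sup C : ℝ≥0)) (δ := δ / (L + 1)) ?_ (by positivity) ?_
    · intro y
      obtain ⟨p, hp⟩ := hleb _ (hφS y)
      rw [(heq p (htS p p.2) y (hp (Metric.mem_ball_self hδ))).fderiv_eq]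
      refine (hM p (htS p p.2) y).trans ((Real.le_coe_toNNReal _).trans ?_)
      exact NNReal.coe_le_coe.2 (Finset.le_sup (f := fun p => (M p).toNNReal) p.2)
    · intro x y hxy
      obtain ⟨p, hp⟩ := hleb _ (hφS y)
      rw [lt_div_iff₀ (by positivity)] at hxy
      have hφxy : dist (φ x) (φ y) < δ := by
        refine (hL.dist_le_mul x y).trans_lt ?_
        nlinarith [dist_nonneg (x := x) (y := y)]
      rw [(heq p (htS p p.2) y (hp (Metric.mem_ball_self hδ))).fderiv_eq,
        (heq p (htS p p.2) x (hp hφxy)).fderiv_eq]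
      refine ((hC p (htS p p.2)).dist_le x y).trans (mul_le_mul_of_nonneg_right ?_ (by positivity))
      exact NNReal.coe_le_coe.2 (Finset.le_sup p.2)

theorem corollary6p5 (N : ℕ) (hN : 2 ≤ N) (ε : ℝ≥0) (hε₀ : 0 < ε) (hε₁ : ε < 1)
    (S : Set (EuclideanSpace ℝ (Fin N))) (hScompact : IsCompact S)
    (hS : IsC1HolderHypersurface ε S)
    (f : EuclideanSpace ℝ (Fin N) → ℝ) (hf : MemHolderSpace ε f)
    (hfS : MemConormal ε S f) :
    MemC1HolderOnSubmanifold (N - 1) ε S (S.domRestrict f) := by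
  intro φ hφ
  exact memC1HolderSpace_comp_of_local_extension hScompact hf.1
    (fun p hp => exists_local_extension_of_memConormal hε₀ hε₁ hS hf hfS hp) hφ.memC1Holder
    fun y => (φ y).2
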